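/- Let $n\in\mathbb N$, let $\Sigma\in\mathbb R^{n\times n}$ be symmetric positive definite, $D=\Sigma^{-1}$, and $\mu\in\mathbb R^n$. For $\theta>0$ let $x^*=x^*(\theta)\in\mathbb R^n$ be the (unique) minimiser over $\mathbb R^n$ of $$h_\theta(x)=\theta\sum_{i=1}^n e^{\mu_i}e^{x_i}+\tfrac12\,x^\top D x .$$ Let $\beta\in\mathbb R^n$ be the (unique) minimiser of $w^\top D w$ over $\{w\in\mathbb R^n : w_i\le -1 \text{ for all } i\}$, and put $F_*=\{i : (D\beta)_i<0\}$, $F_\sim=\{1,\dots,n\}\setminus F_*$. Let $$\overline D = D_{*,*}-D_{*,\sim}\,D_{\sim,\sim}^{-1}\,D_{\sim,*},$$ where the subscripts $*$ and $\sim$ denote the submatrices with rows and columns in $F_*$ and $F_\sim$ respectively, and let $\overline a_i$, $i\in F_*$, be the row sums of $\overline D$. Then $F_*$ is exactly the set of indices $i$ for which there is a constant $c_i\in\mathbb R$ with $$x_i^*=-\log\theta+\log\log\theta-\mu_i+c_i+o(1)\qquad(\theta\to\infty).$$ Moreover, for every $i\in F_*$ one has $\overline a_i>0$ and $$x_i^*=-\log\theta+\log\log\theta-\mu_i+\log\overline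 a_i+o(1)\qquad(\theta\to\infty),$$ that is, $c_i=\log\overline a_i$. -/

import Mathlib

open Filter Topology
open scoped Matrix

noncomputable section

namespace LognormalLaplace

variable {n : ℕ}

/-- The function `h_θ(x) = θ ∑ᵢ exp(μᵢ) exp(xᵢ) + (1/2) xᵀ D x`. -/
def h (D : Matrix (Fin n) (Fin n) ℝ) (μ : Fin n → ℝ) (θ : ℝ) (x : Fin n → ℝ) : ℝ :=
  θ * ∑ i, Real.exp (μ i) * Real.exp (x i) + (1 / 2) * (x ⬝ᵥ (D *ᵥ x))

/-- `x` is a (global) minimiser of `h_θ` on `ℝⁿ`. -/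
def IsMinimiser (D : Matrix (Fin n) (Fin n) ℝ) (μ : Fin n → ℝ) (θ : ℝ)
    (x : Fin n → ℝ) : Prop :=
  IsMinOn (h D μ θ) Set.univ x

/-- `β` is the first column produced by the algorithm: it minimises `wᵀ D w` over the set
of `w` with `wᵢ ≤ -1` for all `i`. -/
def IsFirstColumn (D : Matrix (Fin n) (Fin n) ℝ) (β : Fin n → ℝ) : Prop :=
  (∀ i, β i ≤ -1) ∧
    IsMinOn (fun w : Fin n → ℝ => w ⬝ᵥ (D *ᵥ w)) {w | ∀ i, w i ≤ -1} β

/-- The index set `F_*(1) = {i : (D β)ᵢ < 0}`. -/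
def FStar (D : Matrix (Fin n) (Fin n) ℝ) (β : Fin n → ℝ) : Finset (Fin n) :=
  Finset.univ.filter fun i => (D *ᵥ β) i < 0

/-- The Schur complement `D_{S,S} - D_{S,Sᶜ} D_{Sᶜ,Sᶜ}⁻¹ D_{Sᶜ,S}`. -/
def schurComplement (D : Matrix (Fin n) (Fin n) ℝ) (S : Finset (Fin n)) :
    Matrix {i // i ∈ S} {i // i ∈ S} ℝ :=
  D.toBlock (· ∈ S) (· ∈ S) -
    D.toBlock (· ∈ S) (· ∉ S) * (D.toBlock (· ∉ S) (· ∉ S))⁻¹ * D.toBlock (· ∉ S) (· ∈ S)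

/-- The row sums of the Schur complement. -/
def schurRowSum (D : Matrix (Fin n) (Fin n) ℝ) (S : Finset (Fin n)) (i : {i // i ∈ S}) : ℝ :=
  ∑ j, schurComplement D S i j

/-- The expansion `xᵢ(θ) = -log θ + log log θ - μᵢ + c + o(1)` as `θ → ∞`. -/
def HasExpansion (μ : Fin n → ℝ) (x : ℝ → Fin n → ℝ) (i : Fin n) (c : ℝ) : Prop :=
  Tendsto (fun θ : ℝ => x θ i - (-Real.log θ + Real.log (Real.log θ) - μ i + c)) atTop (𝓝 0)

end LognormalLaplace

end

namespace LognormalLaplace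

section QuadraticForm

variable {n : ℕ} {D Sig : Matrix (Fin n) (Fin n) ℝ}

/-! Taking logarithms in the first-order condition gives `x i = -log θ + log log θ - μ i + log (-(D
x)_i / log θ)` (`IsMinimiser.apply_add_log_eq`), so everything depends on the limit of the last
argument. Since `x / log θ → β` (`tendsto_inv_log_smul_minimiser`), that limit is `-(D β)_i`:
positive on `FStar`, zero off it. On `FStar` it equals the Schur row sum
(`IsFirstColumn.schurRowSum_eq`). -/

theorem dotProduct_mulVec_comm_of_posDef (hD : D.PosDef) (u v : Fin n → ℝ) :
    u ⬝ᵥ (D *ᵥ v) = v ⬝ᵥ (D *ᵥ u) := by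
  have hT : Dᵀ = D := by simpa using hD.isHermitian.eq
  rw [Matrix.dotProduct_mulVec, ← Matrix.mulVec_transpose, hT, dotProduct_comm]

theorem quadForm_nonneg (hD : D.PosDef) (v : Fin n → ℝ) : 0 ≤ v ⬝ᵥ (D *ᵥ v) := by
  simpa using hD.posSemidef.dotProduct_mulVec_nonneg v

theorem quadForm_add_smul (hD : D.PosDef) (u v : Fin n → ℝ) (t : ℝ) :
    (u + t • v) ⬝ᵥ (D *ᵥ (u + t • v)) =
      u ⬝ᵥ (D *ᵥ u) + 2 * t * (v ⬝ᵥ (D *ᵥ u)) + t ^ 2 * (v ⬝ᵥ (D *ᵥ v)) := by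
  simp only [Matrix.mulVec_add, Matrix.mulVec_smul, add_dotProduct, dotProduct_add,
    smul_dotProduct, dotProduct_smul, smul_eq_mul]
  rw [dotProduct_mulVec_comm_of_posDef hD u v]
  ring

theorem quadForm_add_single (hD : D.PosDef) (u : Fin n → ℝ) (i : Fin n) (t : ℝ) :
    (u + t • Pi.single i 1) ⬝ᵥ (D *ᵥ (u + t • Pi.single i 1)) =
      u ⬝ᵥ (D *ᵥ u) + 2 * t * (D *ᵥ u) i + t ^ 2 * D i i := by
  rw [quadForm_add_smul hD]
  simp

/-- Cauchy-Schwarz for the form of `Sig⁻¹`, tested against a column of `Sig`. -/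
theorem sq_apply_le_mul_quadForm_inv (hSig : Sig.PosDef) (z : Fin n → ℝ) (i : Fin n) :
    z i ^ 2 ≤ Sig i i * (z ⬝ᵥ (Sig⁻¹ *ᵥ z)) := by
  have hu : IsUnit Sig.det := hSig.det_pos.ne'.isUnit
  have hq : 0 < Sig i i := hSig.diag_pos
  set u : Fin n → ℝ := Sig *ᵥ Pi.single i 1
  have hDu : Sig⁻¹ *ᵥ u = Pi.single i 1 := by
    simp only [u, Matrix.mulVec_mulVec, Matrix.nonsing_inv_mul _ hu, Matrix.one_mulVec]
  -- The step `-(z i / Sig i i)` minimises the form along `u`.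
  have h1 := quadForm_nonneg hSig.inv (z + (-(z i / Sig i i)) • u)
  rw [quadForm_add_smul hSig.inv, dotProduct_mulVec_comm_of_posDef hSig.inv u z, hDu] at h1
  have huu : u ⬝ᵥ Pi.single i 1 = Sig i i := by simp [u]
  rw [huu] at h1
  simp only [dotProduct_single, mul_one] at h1
  have h2 : 0 ≤ z ⬝ᵥ (Sig⁻¹ *ᵥ z) - z i ^ 2 / Sig i i := by
    convert h1 using 1
    field_simp
    ring
  rw [sub_nonneg, div_le_iff₀ hq] at h2
  linarith

end QuadraticForm

theorem nonneg_of_forall_small_quadratic_nonneg {a b δ : ℝ} (hδ : 0 < δ)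
    (h : ∀ t, 0 < t → t ≤ δ → 0 ≤ 2 * t * a + t ^ 2 * b) : 0 ≤ a := by
  have hlim : Tendsto (fun t : ℝ => 2 * a + t * b) (𝓝[>] 0) (𝓝 (2 * a + 0 * b)) :=
    (Continuous.tendsto (by fun_prop) 0).mono_left nhdsWithin_le_nhds
  have := ge_of_tendsto hlim (b := 0) (by
    filter_upwards [Ioc_mem_nhdsGT hδ] with t ht
    have h1 := h t ht.1 ht.2
    have h2 : 2 * t * a + t ^ 2 * b = t * (2 * a + t * b) := by ring
    rw [h2] at h1
    exact nonneg_of_mul_nonneg_right h1 ht.1)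
  linarith

/-! ### Optimality conditions for `β` -/

section FirstColumn

variable {n : ℕ} {D : Matrix (Fin n) (Fin n) ℝ} {β : Fin n → ℝ}

/-- Lowering a coordinate of `β` keeps it feasible. -/
theorem IsFirstColumn.mulVec_nonpos (hD : D.PosDef) (hβ : IsFirstColumn D β) (i : Fin n) :
    (D *ᵥ β) i ≤ 0 := by
  have : 0 ≤ -(D *ᵥ β) i := by
    refine nonneg_of_forall_small_quadratic_nonneg (b := D i i) one_pos fun t ht _ => ?_
    have hw : ∀ j, (β + (-t) • (Pi.single i 1 : Fin n → ℝ)) j ≤ -1 := by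
      intro j
      have := hβ.1 j
      by_cases hj : j = i
      · subst hj; simp; linarith
      · simp [hj]; linarith
    have := isMinOn_iff.1 hβ.2 _ hw
    rw [quadForm_add_single hD] at this
    linarith
  linarith

/-- A slack coordinate can also be raised, by at most `-1 - β i`. -/
theorem IsFirstColumn.mulVec_eq_zero (hD : D.PosDef) (hβ : IsFirstColumn D β) {i : Fin n}
    (hi : β i < -1) : (D *ᵥ β) i = 0 := by
  refine le_antisymm (hβ.mulVec_nonpos hD i) ?_
  refine nonneg_of_forall_small_quadratic_nonneg (b := D i i) (δ := -1 - β i) (by linarith)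
    fun t ht htδ => ?_
  have hw : ∀ j, (β + t • (Pi.single i 1 : Fin n → ℝ)) j ≤ -1 := by
    intro j
    have := hβ.1 j
    by_cases hj : j = i
    · subst hj; simp; linarith
    · simp [hj]; linarith
  have := isMinOn_iff.1 hβ.2 _ hw
  rw [quadForm_add_single hD] at this
  linarith

theorem IsFirstColumn.mulVec_mul_add_one (hD : D.PosDef) (hβ : IsFirstColumn D β) (i : Fin n) :
    (D *ᵥ β) i * (β i + 1) = 0 := by
  rcases (hβ.1 i).lt_or_eq with h | h
  · rw [hβ.mulVec_eq_zero hD h, zero_mul]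
  · rw [h]; simp

theorem IsFirstColumn.eq_neg_one_of_mem_FStar (hD : D.PosDef) (hβ : IsFirstColumn D β)
    {i : Fin n} (hi : i ∈ FStar D β) : β i = -1 := by
  have h1 : (D *ᵥ β) i < 0 := by simpa [FStar] using hi
  have := (mul_eq_zero.1 (hβ.mulVec_mul_add_one hD i)).resolve_left h1.ne
  linarith

theorem IsFirstColumn.mulVec_eq_zero_of_notMem_FStar (hD : D.PosDef) (hβ : IsFirstColumn D β)
    {i : Fin n} (hi : i ∉ FStar D β) : (D *ᵥ β) i = 0 := by
  have h1 : 0 ≤ (D *ᵥ β) i := by simpa [FStar] using hi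
  exact le_antisymm (hβ.mulVec_nonpos hD i) h1

/-- Stability of the minimiser under constraint violation `ε`: complementary slackness turns the
cross term into a sum of `(y i + 1) * (D β)_i`, where each sign is known. -/
theorem IsFirstColumn.quadForm_sub_le (hD : D.PosDef) (hβ : IsFirstColumn D β)
    {y : Fin n → ℝ} {ε : ℝ} (hy : ∀ i, y i ≤ -1 + ε) :
    (y - β) ⬝ᵥ (D *ᵥ (y - β)) ≤
      y ⬝ᵥ (D *ᵥ y) - β ⬝ᵥ (D *ᵥ β) + 2 * ε * ∑ i, -(D *ᵥ β) i := by
  have h1 : (y - β) ⬝ᵥ (D *ᵥ (y - β)) =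
      y ⬝ᵥ (D *ᵥ y) - β ⬝ᵥ (D *ᵥ β) - 2 * ((y - β) ⬝ᵥ (D *ᵥ β)) := by
    simp only [Matrix.mulVec_sub, sub_dotProduct, dotProduct_sub]
    rw [dotProduct_mulVec_comm_of_posDef hD β y]
    ring
  have h2 : -((y - β) ⬝ᵥ (D *ᵥ β)) ≤ ε * ∑ i, -(D *ᵥ β) i := by
    rw [dotProduct, ← Finset.sum_neg_distrib, Finset.mul_sum]
    refine Finset.sum_le_sum fun i _ => ?_
    have ha := hβ.mulVec_mul_add_one hD i
    have hb : (y i + 1) * -(D *ᵥ β) i ≤ ε * -(D *ᵥ β) i :=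
      mul_le_mul_of_nonneg_right (by linarith [hy i]) (by linarith [hβ.mulVec_nonpos hD i])
    simp only [Pi.sub_apply]
    linarith
  linarith

theorem mulVec_apply_eq_toBlock_add {n : ℕ} (D : Matrix (Fin n) (Fin n) ℝ) (S : Finset (Fin n))
    (p : Fin n → Prop) (v : Fin n → ℝ) (i : {i // p i}) :
    (D *ᵥ v) i = (D.toBlock p (· ∈ S) *ᵥ fun j => v j) i +
      (D.toBlock p (· ∉ S) *ᵥ fun j => v j) i := by
  simp only [Matrix.mulVec, dotProduct, Matrix.toBlock_apply]
  convert (Fintype.sum_subtype_add_sum_subtype (· ∈ S) fun j => D i j * v j).symm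

/-- As `β = -1` on `S` and `D β = 0` off `S`, block elimination expresses the rest of `β` through
the all-ones vector. -/
theorem IsFirstColumn.schurRowSum_eq (hD : D.PosDef) (hβ : IsFirstColumn D β)
    (i : {i // i ∈ FStar D β}) : schurRowSum D (FStar D β) i = -(D *ᵥ β) i := by
  generalize hSdef : FStar D β = S at i
  have hunit : IsUnit (D.toBlock (· ∉ S) (· ∉ S)).det :=
    (hD.submatrix (e := fun j : {j // j ∉ S} => (j : Fin n))
      Subtype.val_injective).det_pos.ne'.isUnit
  have hS : (fun j : {j // j ∈ S} => β j) = -1 := by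
    funext j
    simpa using hβ.eq_neg_one_of_mem_FStar hD (hSdef ▸ j.2)
  have h0 : (D.toBlock (· ∉ S) (· ∈ S) *ᵥ 1) =
      D.toBlock (· ∉ S) (· ∉ S) *ᵥ fun j => β j := by
    funext k
    have h1 := mulVec_apply_eq_toBlock_add D S (· ∉ S) β k
    rw [hβ.mulVec_eq_zero_of_notMem_FStar hD (hSdef ▸ k.2), hS, Matrix.mulVec_neg, Pi.neg_apply] at h1
    linarith
  have hrow : schurRowSum D S i = (schurComplement D S *ᵥ 1) i := by
    simp [schurRowSum, Matrix.mulVec, dotProduct]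
  rw [hrow, schurComplement, Matrix.sub_mulVec, ← Matrix.mulVec_mulVec, h0,
    Matrix.mulVec_mulVec, Matrix.mul_assoc, Matrix.nonsing_inv_mul _ hunit, Matrix.mul_one,
    mulVec_apply_eq_toBlock_add D S (· ∈ S) β i, hS, Matrix.mulVec_neg, Pi.sub_apply,
    Pi.neg_apply]
  ring

end FirstColumn

/-! ### First-order condition and a priori bounds for `x` -/

section Minimiser

variable {n : ℕ} {D : Matrix (Fin n) (Fin n) ℝ} {μ : Fin n → ℝ} {θ : ℝ} {x : Fin n → ℝ}

theorem IsMinimiser.mul_exp_eq (hD : D.PosDef) (hx : IsMinimiser D μ θ x) (i : Fin n) :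
    θ * (Real.exp (μ i) * Real.exp (x i)) = -(D *ᵥ x) i := by
  have hder : HasDerivAt (fun t : ℝ => h D μ θ (x + t • Pi.single i 1))
      (θ * (Real.exp (μ i) * Real.exp (x i)) + (D *ᵥ x) i) 0 := by
    have h1 : HasDerivAt (fun t : ℝ => ∑ j, Real.exp (μ j) *
        Real.exp ((x + t • (Pi.single i 1 : Fin n → ℝ)) j))
        (∑ j, Real.exp (μ j) * (Real.exp (x j) * (Pi.single i 1 : Fin n → ℝ) j)) 0 := by
      refine HasDerivAt.fun_sum fun j _ => HasDerivAt.const_mul _ ?_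
      have := (((hasDerivAt_id (0 : ℝ)).mul_const
        ((Pi.single i 1 : Fin n → ℝ) j)).const_add (x j)).exp
      simpa using this
    have h2 : HasDerivAt (fun t : ℝ => x ⬝ᵥ (D *ᵥ x) + 2 * t * (D *ᵥ x) i + t ^ 2 * D i i)
        (2 * (D *ᵥ x) i) 0 := by
      have := ((((hasDerivAt_id (0 : ℝ)).const_mul 2).mul_const ((D *ᵥ x) i)).const_add
        (x ⬝ᵥ (D *ᵥ x))).add (((hasDerivAt_id (0 : ℝ)).pow 2).mul_const (D i i))
      refine (this.congr_deriv (by simp)).congr_of_eventuallyEq (Eventually.of_forall fun t => ?_)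
      simp
    have h3 := (h1.const_mul θ).add (h2.const_mul (1 / 2))
    refine (h3.congr_deriv ?_).congr_of_eventuallyEq (Eventually.of_forall fun t => ?_)
    · simp [Pi.single_apply]
    · simp only [h, quadForm_add_single hD, Pi.add_apply]
  have hmin : IsLocalMin (fun t : ℝ => h D μ θ (x + t • Pi.single i 1)) 0 :=
    Eventually.of_forall fun t => by
      simpa using isMinOn_iff.1 hx (x + t • Pi.single i 1) (Set.mem_univ _)
  have := hmin.hasDerivAt_eq_zero hder
  linarith

/-- The competitor is `log θ • β`, whose exponentials are at most `θ⁻¹`. -/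
theorem IsMinimiser.h_le {β : Fin n → ℝ} (hx : IsMinimiser D μ θ x) (hβ : ∀ i, β i ≤ -1)
    (hθ : 1 < θ) :
    h D μ θ x ≤ (∑ i, Real.exp (μ i)) + 1 / 2 * (Real.log θ ^ 2 * (β ⬝ᵥ (D *ᵥ β))) := by
  have hθ0 : 0 < θ := one_pos.trans hθ
  refine (isMinOn_iff.1 hx (Real.log θ • β) (Set.mem_univ _)).trans ?_
  unfold h
  have h1 : (Real.log θ • β) ⬝ᵥ (D *ᵥ (Real.log θ • β)) =
      Real.log θ ^ 2 * (β ⬝ᵥ (D *ᵥ β)) := by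
    simp only [Matrix.mulVec_smul, smul_dotProduct, dotProduct_smul, smul_eq_mul]
    ring
  rw [h1, Finset.mul_sum]
  gcongr with i
  have h2 : Real.exp ((Real.log θ • β) i) ≤ θ⁻¹ := by
    rw [← Real.exp_log (inv_pos.2 hθ0), Real.log_inv, Real.exp_le_exp]
    have := mul_le_mul_of_nonneg_left (hβ i) (Real.log_pos hθ).le
    simp only [Pi.smul_apply, smul_eq_mul]
    linarith
  calc θ * (Real.exp (μ i) * Real.exp ((Real.log θ • β) i))
      ≤ θ * (Real.exp (μ i) * θ⁻¹) := by gcongr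
    _ = Real.exp (μ i) := by field_simp

theorem IsMinimiser.quadForm_le {β : Fin n → ℝ} (hx : IsMinimiser D μ θ x)
    (hβ : ∀ i, β i ≤ -1) (hθ : 1 < θ) :
    x ⬝ᵥ (D *ᵥ x) ≤ 2 * (∑ i, Real.exp (μ i)) + Real.log θ ^ 2 * (β ⬝ᵥ (D *ᵥ β)) := by
  have h1 := hx.h_le hβ hθ
  have h2 : 0 ≤ θ * ∑ i, Real.exp (μ i) * Real.exp (x i) := by positivity
  unfold h at h1
  linarith

/-- Dropping the quadratic part bounds each exponential. The factor 2 is not sharp, but the excess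
over `-log θ` is still `o(log θ)`, so `x / log θ` is almost feasible. -/
theorem IsMinimiser.apply_le {β : Fin n → ℝ} (hD : D.PosDef) (hx : IsMinimiser D μ θ x)
    (hβ : ∀ i, β i ≤ -1) (hθ : Real.exp 1 ≤ θ) (i : Fin n) :
    x i ≤ -Real.log θ + 2 * Real.log (Real.log θ) - μ i +
      Real.log ((∑ j, Real.exp (μ j)) + 1 / 2 * (β ⬝ᵥ (D *ᵥ β))) := by
  have hL : 1 ≤ Real.log θ := by
    simpa using Real.log_le_log (Real.exp_pos 1) hθ
  have hθ1 : 1 < θ := (Real.one_lt_exp_iff.2 one_pos).trans_le hθ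
  have hθ0 : 0 < θ := one_pos.trans hθ1
  have hq := quadForm_nonneg hD β
  have hC : 0 < ∑ j, Real.exp (μ j) := Finset.sum_pos (fun j _ => Real.exp_pos _) ⟨i, by simp⟩
  have h1 := hx.h_le hβ hθ1
  have h2 := quadForm_nonneg hD x
  have h3 : Real.exp (μ i) * Real.exp (x i) ≤ ∑ j, Real.exp (μ j) * Real.exp (x j) :=
    Finset.single_le_sum (f := fun j => Real.exp (μ j) * Real.exp (x j))
      (fun j _ => by positivity) (Finset.mem_univ i)
  have h4 : θ * (Real.exp (μ i) * Real.exp (x i)) ≤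
      Real.log θ ^ 2 * ((∑ j, Real.exp (μ j)) + 1 / 2 * (β ⬝ᵥ (D *ᵥ β))) := by
    have h5 := mul_le_mul_of_nonneg_left h3 hθ0.le
    have h6 : ∑ j, Real.exp (μ j) ≤ Real.log θ ^ 2 * ∑ j, Real.exp (μ j) :=
      le_mul_of_one_le_left hC.le (one_le_pow₀ hL)
    unfold h at h1
    linarith
  have h7 := Real.log_le_log (by positivity) h4
  have hL0 : Real.log θ ≠ 0 := by positivity
  rw [Real.log_mul hθ0.ne' (by positivity), Real.log_mul (by positivity) (by positivity),
    Real.log_exp, Real.log_exp, Real.log_mul (by positivity) (by positivity), Real.log_pow] at h7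
  push_cast at h7
  linarith

end Minimiser

/-! ### Convergence of the rescaled minimisers -/

section Asymptotics

variable {n : ℕ} {D Sig : Matrix (Fin n) (Fin n) ℝ} {μ β : Fin n → ℝ} {x : ℝ → Fin n → ℝ}

theorem tendsto_log_log_div_log :
    Tendsto (fun θ : ℝ => Real.log (Real.log θ) / Real.log θ) atTop (𝓝 0) :=
  Real.isLittleO_log_id_atTop.tendsto_div_nhds_zero.comp Real.tendsto_log_atTop

theorem tendsto_const_div_log (c : ℝ) :
    Tendsto (fun θ : ℝ => c / Real.log θ) atTop (𝓝 0) :=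
  Real.tendsto_log_atTop.const_div_atTop c

/-- The rescaled minimisers `x(θ) / log θ` converge to the first column `β`. -/
theorem tendsto_inv_log_smul_minimiser (hSig : Sig.PosDef)
    (hx : ∀ θ : ℝ, 0 < θ → IsMinimiser Sig⁻¹ μ θ (x θ)) (hβ : IsFirstColumn Sig⁻¹ β) :
    Tendsto (fun θ => (Real.log θ)⁻¹ • x θ) atTop (𝓝 β) := by
  have hD := hSig.inv
  set D := Sig⁻¹
  set C : ℝ := ∑ i, Real.exp (μ i)
  set K : ℝ := ∑ i, |μ i| + |Real.log (C + 1 / 2 * (β ⬝ᵥ (D *ᵥ β)))|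
  set ε : ℝ → ℝ := fun θ => 2 * (Real.log (Real.log θ) / Real.log θ) + K / Real.log θ
  set A : ℝ := ∑ i, -(D *ᵥ β) i
  have hε : Tendsto ε atTop (𝓝 0) := by
    simpa using (tendsto_log_log_div_log.const_mul 2).add (tendsto_const_div_log K)
  have hbound : ∀ᶠ θ in atTop, ∀ i, ((Real.log θ)⁻¹ • x θ - β) i ^ 2 ≤
      Sig i i * (2 * C / Real.log θ * (1 / Real.log θ) + 2 * ε θ * A) := by
    filter_upwards [eventually_ge_atTop (Real.exp 1)] with θ hθ i
    have hθ1 : 1 < θ := (Real.one_lt_exp_iff.2 one_pos).trans_le hθ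
    have hL : 0 < Real.log θ := Real.log_pos hθ1
    have hxθ := hx θ (one_pos.trans hθ1)
    have hy : ∀ j, ((Real.log θ)⁻¹ • x θ) j ≤ -1 + ε θ := by
      intro j
      have h1 := hxθ.apply_le hD hβ.1 hθ j
      have h2 : |μ j| ≤ ∑ i, |μ i| :=
        Finset.single_le_sum (f := fun i => |μ i|) (fun i _ => abs_nonneg _) (Finset.mem_univ j)
      have h3 := neg_abs_le (μ j)
      have h4 := le_abs_self (Real.log (C + 1 / 2 * (β ⬝ᵥ (D *ᵥ β))))
      have h5 : x θ j ≤ -Real.log θ + 2 * Real.log (Real.log θ) + K := by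
        simp only [K]
        linarith
      have h6 : -1 + ε θ = (-Real.log θ + 2 * Real.log (Real.log θ) + K) / Real.log θ := by
        simp only [ε]
        field_simp
        ring
      rw [h6, Pi.smul_apply, smul_eq_mul, inv_mul_eq_div]
      gcongr
    refine (sq_apply_le_mul_quadForm_inv hSig _ i).trans ?_
    refine mul_le_mul_of_nonneg_left ?_ hSig.diag_pos.le
    refine (hβ.quadForm_sub_le hD hy).trans ?_
    have h1 := hxθ.quadForm_le hβ.1 hθ1
    have h2 : ((Real.log θ)⁻¹ • x θ) ⬝ᵥ (D *ᵥ ((Real.log θ)⁻¹ • x θ)) =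
        (x θ ⬝ᵥ (D *ᵥ x θ)) / Real.log θ ^ 2 := by
      simp only [Matrix.mulVec_smul, smul_dotProduct, dotProduct_smul, smul_eq_mul]
      field_simp
    have h3 : (x θ ⬝ᵥ (D *ᵥ x θ)) / Real.log θ ^ 2 ≤
        2 * C / Real.log θ * (1 / Real.log θ) + β ⬝ᵥ (D *ᵥ β) := by
      rw [div_le_iff₀ (by positivity)]
      refine h1.trans_eq ?_
      simp only [C]
      field_simp
    rw [h2]
    linarith
  refine tendsto_pi_nhds.2 fun i => ?_
  have hlim : Tendsto (fun θ => Sig i i *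
      (2 * C / Real.log θ * (1 / Real.log θ) + 2 * ε θ * A)) atTop (𝓝 0) := by
    simpa using ((((tendsto_const_div_log (2 * C)).mul (tendsto_const_div_log 1)).add
      ((hε.const_mul 2).mul_const A)).const_mul (Sig i i))
  have hsq : Tendsto (fun θ => ((Real.log θ)⁻¹ • x θ - β) i ^ 2) atTop (𝓝 0) :=
    squeeze_zero' (Eventually.of_forall fun θ => sq_nonneg _) (hbound.mono fun θ h => h i) hlim
  have habs : Tendsto (fun θ => |((Real.log θ)⁻¹ • x θ - β) i|) atTop (𝓝 0) := by
    simpa [Real.sqrt_sq_eq_abs] using hsq.sqrt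
  have := (tendsto_zero_iff_abs_tendsto_zero _).2 habs
  simpa using this.add_const (β i)

theorem tendsto_neg_mulVec_div_log (hSig : Sig.PosDef)
    (hx : ∀ θ : ℝ, 0 < θ → IsMinimiser Sig⁻¹ μ θ (x θ)) (hβ : IsFirstColumn Sig⁻¹ β)
    (i : Fin n) :
    Tendsto (fun θ => -(Sig⁻¹ *ᵥ x θ) i / Real.log θ) atTop (𝓝 (-(Sig⁻¹ *ᵥ β) i)) := by
  have hc : Continuous fun v : Fin n → ℝ => -(Sig⁻¹ *ᵥ v) i := by fun_prop
  refine ((hc.tendsto β).comp (tendsto_inv_log_smul_minimiser hSig hx hβ)).congr fun θ => ?_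
  simp [Matrix.mulVec_smul, div_eq_inv_mul]

/-- The first-order condition in logarithmic form. -/
theorem IsMinimiser.apply_add_log_eq {θ : ℝ} {v : Fin n → ℝ} (hD : D.PosDef)
    (hv : IsMinimiser D μ θ v) (hθ : 1 < θ) (i : Fin n) :
    0 < -(D *ᵥ v) i / Real.log θ ∧
      v i - (-Real.log θ + Real.log (Real.log θ) - μ i) =
        Real.log (-(D *ᵥ v) i / Real.log θ) := by
  have hθ0 : 0 < θ := one_pos.trans hθ
  have hL : 0 < Real.log θ := Real.log_pos hθ
  rw [← hv.mul_exp_eq hD i]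
  refine ⟨by positivity, ?_⟩
  rw [Real.log_div (by positivity) hL.ne', Real.log_mul hθ0.ne' (by positivity),
    Real.log_mul (by positivity) (by positivity), Real.log_exp, Real.log_exp]
  ring

end Asymptotics

end LognormalLaplace

theorem mainTheorem4 (n : ℕ) (Sig : Matrix (Fin n) (Fin n) ℝ) (hSig : Sig.PosDef)
    (D : Matrix (Fin n) (Fin n) ℝ) (hD : D = Sig⁻¹) (μ : Fin n → ℝ)
    (x : ℝ → Fin n → ℝ) (hx : ∀ θ : ℝ, 0 < θ → LognormalLaplace.IsMinimiser D μ θ (x θ))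
    (β : Fin n → ℝ) (hβ : LognormalLaplace.IsFirstColumn D β) :
    (∀ i : Fin n, i ∈ LognormalLaplace.FStar D β ↔
      ∃ c : ℝ, LognormalLaplace.HasExpansion μ x i c) ∧
    (∀ i : {i // i ∈ LognormalLaplace.FStar D β},
      0 < LognormalLaplace.schurRowSum D (LognormalLaplace.FStar D β) i ∧
      LognormalLaplace.HasExpansion μ x i
        (Real.log (LognormalLaplace.schurRowSum D (LognormalLaplace.FStar D β) i))) := by
  subst hD
  have hlim := LognormalLaplace.tendsto_neg_mulVec_div_log hSig hx hβ
  have hfoc : ∀ᶠ θ in atTop, ∀ i, 0 < -(Sig⁻¹ *ᵥ x θ) i / Real.log θ ∧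
      x θ i - (-Real.log θ + Real.log (Real.log θ) - μ i) =
        Real.log (-(Sig⁻¹ *ᵥ x θ) i / Real.log θ) := by
    filter_upwards [eventually_gt_atTop 1] with θ hθ i
    exact (hx θ (one_pos.trans hθ)).apply_add_log_eq hSig.inv hθ i
  have hmem : ∀ i : {i // i ∈ LognormalLaplace.FStar Sig⁻¹ β},
      0 < LognormalLaplace.schurRowSum Sig⁻¹ (LognormalLaplace.FStar Sig⁻¹ β) i ∧
      LognormalLaplace.HasExpansion μ x i
        (Real.log (LognormalLaplace.schurRowSum Sig⁻¹ (LognormalLaplace.FStar Sig⁻¹ β) i)) := by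
    intro i
    have hi : (Sig⁻¹ *ᵥ β) i < 0 := by simpa [LognormalLaplace.FStar] using i.2
    rw [hβ.schurRowSum_eq hSig.inv i]
    refine ⟨by linarith, ?_⟩
    have h1 := ((hlim i).log (by linarith)).sub_const (Real.log (-(Sig⁻¹ *ᵥ β) i))
    rw [sub_self] at h1
    refine h1.congr' (hfoc.mono fun θ h => ?_)
    rw [← (h i).2]
    ring
  refine ⟨fun i => ⟨fun hi => ⟨_, (hmem ⟨i, hi⟩).2⟩, ?_⟩, hmem⟩
  rintro ⟨c, hc⟩
  by_contra hi
  -- Exponentiating an expansion would force a positive limit, whereas off `FStar` the limit is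
  -- zero.
  have h1 : Tendsto (fun θ => -(Sig⁻¹ *ᵥ x θ) i / Real.log θ) atTop (𝓝 (Real.exp (0 + c))) := by
    refine (hc.add_const c).rexp.congr' (hfoc.mono fun θ h => ?_)
    have h3 := Real.exp_log (h i).1
    rw [← (h i).2] at h3
    refine Eq.trans ?_ h3
    congr 1
    ring
  have h2 := tendsto_nhds_unique h1 (hlim i)
  rw [hβ.mulVec_eq_zero_of_notMem_FStar hSig.inv hi, neg_zero] at h2
  exact (Real.exp_pos _).ne' h2
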